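/- Let $G$ be a complete graph on $n$ vertices whose edges have signs $\pm1$; neighbours, degrees and the maximum degree refer to the positive edges. Let $\Delta\ge 2$ be the maximum degree of $G$ and let $0<\epsilon\le 1$. Both algorithms below draw a uniformly random order $\pi$ of the vertices and then work in rounds until every vertex is clustered. In a round that starts with $n_i\ge 1$ unclustered vertices, let $\Delta_i$ be the maximum degree of the subgraph that they induce; the active set $\mathcal A$ consists of the first $\lceil \epsilon n_i/\Delta_i\rceil$ unclustered vertices in the order $\pi$ (of all unclustered vertices if $\Delta_i=0$). In ClusterWild! every vertex of $\mathcal A$ becomes a cluster center; in C4 a vertex of $\mathcal A$ becomes a cluster center if and only if no neighbour of it in $\mathcal A$ that precedes it in $\pi$ is a cluster center. Every other unclustered vertex that is adjacent to a center of this round joins the cluster of the first such center in $\pi$. The clustered vertices are then removed from the graph. Put $\Delta_i=0$ when no vertex is left, so that $\Delta_i$ is the maximum degree of the remaining graph after $i$ rounds. For every $c>0$ there is a constant $C>0$, depending only on $c$, such that for all such $G$ and $\epsilon$ and for each of the two algorithms: (1) with probability at least $1-n^{-c}$, the algorithm terminates after at most $C\cdot\frac1\epsilon\log n\cdot\log\Delta$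 rounds; (2) with probability at least $1-n^{-c}$, the maximum degree halves every $O(\frac1\epsilon\log n)$ rounds: $\Delta_{i+s}\le \Delta_i/2$ for all integers $i\ge 0$ and $s\ge C\cdot\frac1\epsilon\log n$. -/

import Mathlib

namespace ParallelCC

/-- The two parallel correlation clustering algorithms. -/
inductive Algorithm where
  | c4
  | clusterWild

variable {n : ℕ}

/-- A (partial) clustering: the cluster ID of each vertex, where `⊤` (infinity) means that the
vertex is still unclustered. -/
abbrev ClusterID (n : ℕ) : Type := Fin n → ℕ∞

/-- The vertices that are still unclustered. -/
def unclustered (cid : ClusterID n) : Finset (Fin n) :=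
  Finset.univ.filter (fun v => cid v = ⊤)

/-- The maximum degree of the subgraph of `G` induced on `U` (it is `0` if `U` is empty).
Here and below `G` is the graph of positive edges of the complete signed graph. -/
def maxDeg (G : SimpleGraph (Fin n)) [DecidableRel G.Adj] (U : Finset (Fin n)) : ℕ :=
  U.sup (fun v => (U.filter (fun u => G.Adj v u)).card)

/-- The size of the next batch when `U` is the set of unclustered vertices: `ε * |U| / Δ(U)`
rounded up, and all of `U` if no positive edge is left (when the quotient is infinite). -/
noncomputable def batchSize (G : SimpleGraph (Fin n)) [DecidableRel G.Adj] (ε : ℝ)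
    (U : Finset (Fin n)) : ℕ :=
  if maxDeg G U = 0 then U.card else ⌈ε * (U.card : ℝ) / (maxDeg G U : ℝ)⌉₊

/-- The first `B` vertices of `U` in the order of `π`; `π v` is the rank of the vertex `v`. -/
def firstVertices (π : Equiv.Perm (Fin n)) (U : Finset (Fin n)) (B : ℕ) : Finset (Fin n) :=
  U.filter (fun v => (U.filter (fun u => π u < π v)).card < B)

/-- The active set of a round that starts with the set `U` of unclustered vertices. -/
noncomputable def activeSet (G : SimpleGraph (Fin n)) [DecidableRel G.Adj] (ε : ℝ)
    (π : Equiv.Perm (Fin n)) (U : Finset (Fin n)) : Finset (Fin n) :=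
  firstVertices π U (batchSize G ε U)

/-- The routine `isCenter` of C4 for the active set `A`: an active vertex is a cluster center iff
none of its neighbours that precede it in the order of `π` is a cluster center. -/
def IsCenter (G : SimpleGraph (Fin n)) (π : Equiv.Perm (Fin n)) (A : Finset (Fin n))
    (v : Fin n) : Prop :=
  ∀ u ∈ A, G.Adj v u → π u < π v → ¬ IsCenter G π A u
termination_by (π v).val

open Classical in
/-- The vertices of the active set `A` around which a cluster is created: in ClusterWild! all of
them, in C4 those that pass the test `isCenter`. -/
noncomputable def centers (alg : Algorithm) (G : SimpleGraph (Fin n)) (π : Equiv.Perm (Fin n))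
    (A : Finset (Fin n)) : Finset (Fin n) :=
  match alg with
  | Algorithm.c4 => A.filter (fun v => IsCenter G π A v)
  | Algorithm.clusterWild => A

/-- Cluster creation around all vertices of `S`: a center `v` gets the ID `π v`, and every other
vertex that was unclustered gets the smallest ID among its neighbours in `S` (and stays
unclustered if there is none). -/
noncomputable def createClusters (G : SimpleGraph (Fin n)) [DecidableRel G.Adj] (π : Equiv.Perm (Fin n))
    (S : Finset (Fin n)) (cid : ClusterID n) : ClusterID n :=
  fun v =>
    if cid v ≠ ⊤ then cid v
    else if v ∈ S then ((π v : ℕ) : ℕ∞)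
    else (S.filter (fun u => G.Adj v u)).inf (fun u => ((π u : ℕ) : ℕ∞))

/-- One round: sample the active set, create the clusters. (Clustered vertices leave the graph,
since every round works with the unclustered vertices only.) -/
noncomputable def round (alg : Algorithm) (G : SimpleGraph (Fin n)) [DecidableRel G.Adj] (ε : ℝ)
    (π : Equiv.Perm (Fin n)) (cid : ClusterID n) : ClusterID n :=
  createClusters G π (centers alg G π (activeSet G ε π (unclustered cid))) cid

/-- The state after `t` rounds; initially every vertex is unclustered. If no unclustered vertex is
left, further rounds change nothing. -/
noncomputable def run (alg : Algorithm) (G : SimpleGraph (Fin n)) [DecidableRel G.Adj] (ε : ℝ)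
    (π : Equiv.Perm (Fin n)) : ℕ → ClusterID n
  | 0 => fun _ => ⊤
  | t + 1 => round alg G ε π (run alg G ε π t)

/-- The vertices that are unclustered after `t` rounds. -/
noncomputable def remaining (alg : Algorithm) (G : SimpleGraph (Fin n)) [DecidableRel G.Adj]
    (ε : ℝ) (π : Equiv.Perm (Fin n)) (t : ℕ) : Finset (Fin n) :=
  unclustered (run alg G ε π t)

/-- The algorithm terminates after at most `T` rounds. -/
def TerminatesWithin (alg : Algorithm) (G : SimpleGraph (Fin n)) [DecidableRel G.Adj]
    (ε : ℝ) (π : Equiv.Perm (Fin n)) (T : ℝ) : Prop :=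
  ∃ t : ℕ, (t : ℝ) ≤ T ∧ remaining alg G ε π t = ∅

/-- The probability of an event `E` for a uniformly random permutation of the `n` vertices. -/
noncomputable def permProb (n : ℕ) (E : Set (Equiv.Perm (Fin n))) : ℝ :=
  (E.ncard : ℝ) / (Fintype.card (Equiv.Perm (Fin n)) : ℝ)

end ParallelCC

/-! Reveal the order one vertex at a time. In a round on `U` with maximum degree `D`, suppose that
`v` and more than `D / 2` of its neighbours have survived the first `j` vertices. The next vertex is
uniform among those of `U` not yet seen, so with probability at least `D / (2 |U|)` it is a
surviving neighbour of `v`. Such a vertex has no earlier adjacent center, hence is a center in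
either algorithm, and `v` gets clustered. Over the about `ε |U| / D` vertices of a batch, `v` stays
heavy with probability at most `exp (-ε / 2)` (`card_staysHeavy_batchSize_le`).

Uniformity is a counting statement (`card_filter_notMem_le`): exchanging the ranks of two unseen
vertices leaves everything seen so far unchanged. This also holds across rounds (`run_mul`), so the
factors multiply (`card_heavyAt_le`).

If the degree fails to halve, a vertex of maximum degree at the end was heavy in every round in
between. A union bound over starting rounds and vertices gives (2). On the same event, about `log₂
Δ` halvings and one more round end the algorithm, which gives (1). -/

namespace ParallelCC

variable {n : ℕ}

/-! ### Ranks and initial segments -/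

/-- The number of vertices of `U` that precede `v` in the order of `π`. -/
def orderRank (π : Equiv.Perm (Fin n)) (U : Finset (Fin n)) (v : Fin n) : ℕ :=
  (U.filter (fun u => π u < π v)).card

theorem mem_firstVertices {π : Equiv.Perm (Fin n)} {U : Finset (Fin n)} {B : ℕ} {v : Fin n} :
    v ∈ firstVertices π U B ↔ v ∈ U ∧ orderRank π U v < B := by
  simp [firstVertices, orderRank]

theorem orderRank_mono {π : Equiv.Perm (Fin n)} {U : Finset (Fin n)} {u v : Fin n}
    (h : π u ≤ π v) : orderRank π U u ≤ orderRank π U v :=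
  Finset.card_le_card (Finset.monotone_filter_right _ fun _ _ hw => lt_of_lt_of_le hw h)

theorem orderRank_lt {π : Equiv.Perm (Fin n)} {U : Finset (Fin n)} {u v : Fin n}
    (hu : u ∈ U) (h : π u < π v) : orderRank π U u < orderRank π U v := by
  refine Finset.card_lt_card ((Finset.ssubset_iff_of_subset
    (Finset.monotone_filter_right _ fun _ _ hw => lt_trans hw h)).2 ⟨u, ?_, ?_⟩) <;> simp [hu, h]

theorem orderRank_injOn (π : Equiv.Perm (Fin n)) (U : Finset (Fin n)) :
    Set.InjOn (orderRank π U) U := by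
  intro u hu v hv h
  rcases lt_trichotomy (π u) (π v) with h' | h' | h'
  · exact absurd h (orderRank_lt hu h').ne
  · exact π.injective h'
  · exact absurd h (orderRank_lt hv h').ne'

theorem orderRank_lt_card {π : Equiv.Perm (Fin n)} {U : Finset (Fin n)} {v : Fin n}
    (hv : v ∈ U) : orderRank π U v < U.card := by
  refine Finset.card_lt_card ((Finset.ssubset_iff_of_subset (Finset.filter_subset _ _)).2
    ⟨v, hv, by simp⟩)

theorem exists_orderRank_eq (π : Equiv.Perm (Fin n)) {U : Finset (Fin n)} {j : ℕ}
    (hj : j < U.card) : ∃ v ∈ U, orderRank π U v = j := by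
  have himg : U.image (orderRank π U) = Finset.range U.card := by
    refine Finset.eq_of_subset_of_card_le ?_ ?_
    · intro k hk
      obtain ⟨v, hv, rfl⟩ := Finset.mem_image.1 hk
      exact Finset.mem_range.2 (orderRank_lt_card hv)
    · rw [Finset.card_image_of_injOn (orderRank_injOn π U), Finset.card_range]
  have : j ∈ U.image (orderRank π U) := himg ▸ Finset.mem_range.2 hj
  simpa using this

theorem firstVertices_subset (π : Equiv.Perm (Fin n)) (U : Finset (Fin n)) (B : ℕ) :
    firstVertices π U B ⊆ U :=
  Finset.filter_subset _ _

theorem firstVertices_nonempty (π : Equiv.Perm (Fin n)) {U : Finset (Fin n)} (hU : U.Nonempty)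
    {B : ℕ} (hB : 0 < B) : (firstVertices π U B).Nonempty := by
  obtain ⟨v, hv, h⟩ := exists_orderRank_eq π hU.card_pos
  exact ⟨v, mem_firstVertices.2 ⟨hv, h ▸ hB⟩⟩

theorem firstVertices_of_card_le (π : Equiv.Perm (Fin n)) {U : Finset (Fin n)} {B : ℕ}
    (hB : U.card ≤ B) : firstVertices π U B = U := by
  ext v
  rw [mem_firstVertices]
  exact ⟨fun h => h.1, fun h => ⟨h, (orderRank_lt_card h).trans_le hB⟩⟩

/-! ### Permutations of the vertices that come later -/

/-- `σ` moves vertices of `W` only. -/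
def SupportedOn (σ : Equiv.Perm (Fin n)) (W : Finset (Fin n)) : Prop :=
  ∀ v, v ∉ W → σ v = v

theorem SupportedOn.mono {σ : Equiv.Perm (Fin n)} {W U : Finset (Fin n)}
    (h : SupportedOn σ W) (hWU : W ⊆ U) : SupportedOn σ U :=
  fun v hv => h v fun hw => hv (hWU hw)

theorem SupportedOn.apply_mem_iff {σ : Equiv.Perm (Fin n)} {W : Finset (Fin n)}
    (h : SupportedOn σ W) {v : Fin n} : σ v ∈ W ↔ v ∈ W := by
  constructor
  · intro hv
    by_contra hc
    exact hc (h v hc ▸ hv)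
  · intro hv
    by_contra hc
    exact hc ((σ.injective (h _ hc)).symm ▸ hv)

theorem supportedOn_swap {W : Finset (Fin n)} {y z : Fin n} (hy : y ∈ W) (hz : z ∈ W) :
    SupportedOn (Equiv.swap y z) W := fun _ hv =>
  Equiv.swap_apply_of_ne_of_ne (fun h => hv (h ▸ hy)) (fun h => hv (h ▸ hz))

theorem orderRank_mul {σ : Equiv.Perm (Fin n)} {U : Finset (Fin n)} (h : SupportedOn σ U)
    (π : Equiv.Perm (Fin n)) (v : Fin n) :
    orderRank (π * σ) U v = orderRank π U (σ v) := by
  refine Finset.card_equiv σ fun u => ?_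
  rw [Finset.mem_filter, Finset.mem_filter, h.apply_mem_iff]
  rfl

theorem firstVertices_mul {σ : Equiv.Perm (Fin n)} {W U : Finset (Fin n)}
    {π : Equiv.Perm (Fin n)} {B : ℕ} (h : SupportedOn σ W) (hWU : W ⊆ U)
    (hW : ∀ v ∈ W, v ∉ firstVertices π U B) :
    firstVertices (π * σ) U B = firstVertices π U B := by
  ext v
  rw [mem_firstVertices, mem_firstVertices, orderRank_mul (h.mono hWU)]
  by_cases hv : v ∈ W
  · have h1 := hW v hv
    have h2 := hW (σ v) (h.apply_mem_iff.2 hv)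
    rw [mem_firstVertices] at h1 h2
    have := hWU hv
    have := hWU (h.apply_mem_iff.2 hv)
    tauto
  · rw [h v hv]

/-! ### Centers -/

/-- The recursion looks only at earlier active vertices, so an initial segment `A` of `A'` decides
its own centers, and only the ranks on `A` matter. -/
theorem isCenter_congr {G : SimpleGraph (Fin n)} {π π' : Equiv.Perm (Fin n)}
    {A A' : Finset (Fin n)} (hAA' : A ⊆ A') (hπ : ∀ v ∈ A, π' v = π v)
    (hlow : ∀ v ∈ A, ∀ u ∈ A', π u < π v → u ∈ A) {v : Fin n} (hv : v ∈ A) :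
    IsCenter G π A' v ↔ IsCenter G π' A v := by
  induction hk : (π v).val using Nat.strong_induction_on generalizing v with
  | _ k ih =>
    rw [IsCenter, IsCenter]
    constructor
    · intro h u hu hadj hlt
      rw [hπ u hu, hπ v hv] at hlt
      rw [← ih _ (hk ▸ hlt) hu rfl]
      exact h u (hAA' hu) hadj hlt
    · intro h u hu hadj hlt
      have huA := hlow v hv u hu hlt
      rw [ih _ (hk ▸ hlt) huA rfl]
      exact h u huA hadj (by rwa [hπ u huA, hπ v hv])

theorem mem_centers_congr {alg : Algorithm} {G : SimpleGraph (Fin n)}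
    {π π' : Equiv.Perm (Fin n)} {A A' : Finset (Fin n)} (hAA' : A ⊆ A')
    (hπ : ∀ v ∈ A, π' v = π v) (hlow : ∀ v ∈ A, ∀ u ∈ A', π u < π v → u ∈ A)
    {v : Fin n} (hv : v ∈ A) : v ∈ centers alg G π A' ↔ v ∈ centers alg G π' A := by
  cases alg
  · simp [centers, hv, hAA' hv, isCenter_congr hAA' hπ hlow hv]
  · simp [centers, hv, hAA' hv]

theorem centers_subset (alg : Algorithm) (G : SimpleGraph (Fin n)) (π : Equiv.Perm (Fin n))
    (A : Finset (Fin n)) : centers alg G π A ⊆ A := by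
  cases alg <;> simp [centers]

theorem centers_congr (alg : Algorithm) (G : SimpleGraph (Fin n)) {π π' : Equiv.Perm (Fin n)}
    {A : Finset (Fin n)} (hπ : ∀ v ∈ A, π' v = π v) :
    centers alg G π' A = centers alg G π A := by
  ext v
  by_cases hv : v ∈ A
  · exact (mem_centers_congr subset_rfl hπ (fun _ _ _ hu _ => hu) hv).symm
  · exact iff_of_false (fun h => hv (centers_subset _ _ _ _ h))
      (fun h => hv (centers_subset _ _ _ _ h))

theorem exists_adj_center {alg : Algorithm} {G : SimpleGraph (Fin n)}
    {π : Equiv.Perm (Fin n)} {A : Finset (Fin n)} {v : Fin n} (hv : v ∈ A)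
    (hc : v ∉ centers alg G π A) :
    ∃ u ∈ centers alg G π A, G.Adj v u ∧ π u < π v := by
  cases alg
  · simp only [centers, Finset.mem_filter, hv, true_and] at hc ⊢
    rw [IsCenter] at hc
    push Not at hc
    obtain ⟨u, hu, hadj, hlt, h⟩ := hc
    exact ⟨u, ⟨hu, h⟩, hadj, hlt⟩
  · exact absurd hv hc

/-! ### Vertices that survive a batch -/

open Classical in
/-- The vertices of `U` that are still unclustered after the batch `A` has been processed. -/
noncomputable def survivors (alg : Algorithm) (G : SimpleGraph (Fin n))
    (π : Equiv.Perm (Fin n)) (U A : Finset (Fin n)) : Finset (Fin n) :=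
  U.filter (fun u => u ∉ A ∧ ∀ w ∈ centers alg G π A, ¬ G.Adj u w)

theorem mem_survivors {alg : Algorithm} {G : SimpleGraph (Fin n)}
    {π : Equiv.Perm (Fin n)} {U A : Finset (Fin n)} {v : Fin n} :
    v ∈ survivors alg G π U A ↔
      v ∈ U ∧ v ∉ A ∧ ∀ w ∈ centers alg G π A, ¬ G.Adj v w := by
  simp [survivors]

theorem survivors_congr (alg : Algorithm) (G : SimpleGraph (Fin n))
    {π π' : Equiv.Perm (Fin n)} (U : Finset (Fin n)) {A : Finset (Fin n)}
    (hπ : ∀ v ∈ A, π' v = π v) : survivors alg G π' U A = survivors alg G π U A := by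
  ext v
  rw [mem_survivors, mem_survivors, centers_congr alg G hπ]

/-- Centers of a prefix remain centers of a longer prefix, so processing more vertices never frees a
clustered one. -/
theorem survivors_firstVertices_subset (alg : Algorithm) (G : SimpleGraph (Fin n))
    (π : Equiv.Perm (Fin n)) (U : Finset (Fin n)) {j k : ℕ} (hjk : j ≤ k) :
    survivors alg G π U (firstVertices π U k) ⊆ survivors alg G π U (firstVertices π U j) := by
  intro v hv
  rw [mem_survivors] at hv ⊢
  have hsub : firstVertices π U j ⊆ firstVertices π U k := fun u hu => by
    rw [mem_firstVertices] at hu ⊢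
    exact ⟨hu.1, hu.2.trans_le hjk⟩
  refine ⟨hv.1, fun h => hv.2.1 (hsub h), fun w hw => hv.2.2 w ?_⟩
  refine (mem_centers_congr (π' := π) hsub (fun _ _ => rfl) ?_
    (centers_subset _ _ _ _ hw)).2 hw
  intro x hx u hu hlt
  rw [mem_firstVertices] at hx hu ⊢
  exact ⟨hu.1, (orderRank_mono hlt.le).trans_lt hx.2⟩

/-- A vertex that survives the first `j` vertices of `U` and comes next is a center. -/
theorem mem_centers_of_orderRank_eq {alg : Algorithm} {G : SimpleGraph (Fin n)}
    {π : Equiv.Perm (Fin n)} {U : Finset (Fin n)} {j : ℕ} {w : Fin n}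
    (hw : w ∈ survivors alg G π U (firstVertices π U j)) (hr : orderRank π U w = j) :
    w ∈ centers alg G π (firstVertices π U (j + 1)) := by
  rw [mem_survivors] at hw
  -- A non-center has an earlier adjacent center; that one lies among the first `j` vertices and
  -- would already have clustered `w`.
  by_contra hc
  obtain ⟨u, hu, hadj, hlt⟩ :=
    exists_adj_center (mem_firstVertices.2 ⟨hw.1, by omega⟩) hc
  have huA := mem_firstVertices.1 (centers_subset _ _ _ _ hu)
  have huj : u ∈ firstVertices π U j :=
    mem_firstVertices.2 ⟨huA.1, hr ▸ orderRank_lt huA.1 hlt⟩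
  refine hw.2.2 u ((mem_centers_congr (π' := π) ?_ (fun _ _ => rfl) ?_ huj).1 hu) hadj
  · intro x hx
    rw [mem_firstVertices] at hx ⊢
    exact ⟨hx.1, by omega⟩
  · intro x hx y hy hlt
    rw [mem_firstVertices] at hx hy ⊢
    exact ⟨hy.1, (orderRank_mono hlt.le).trans_lt hx.2⟩

/-! ### Rounds in terms of survivors, and their invariance under late exchanges -/

variable (alg : Algorithm) (G : SimpleGraph (Fin n)) [DecidableRel G.Adj] (ε : ℝ)

theorem unclustered_round (π : Equiv.Perm (Fin n)) (cid : ClusterID n) :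
    unclustered (round alg G ε π cid) =
      survivors alg G π (unclustered cid) (activeSet G ε π (unclustered cid)) := by
  ext v
  set A := activeSet G ε π (unclustered cid) with hA
  have key : v ∈ unclustered (round alg G ε π cid) ↔
      cid v = ⊤ ∧ v ∉ centers alg G π A ∧ ∀ w ∈ centers alg G π A, ¬ G.Adj v w := by
    rw [unclustered, Finset.mem_filter, round, ← hA, createClusters]
    simp only [Finset.mem_univ, true_and]
    split_ifs with h1 h2
    · simp [h1]
    · simp [h2]
    · simp only [ne_eq, not_not] at h1
      -- Ranks are finite, so the infimum is `⊤` exactly when no center is adjacent to `v`.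
      rw [Finset.inf_eq_top_iff]
      simp [h1, h2]
  rw [key, mem_survivors]
  have hU : v ∈ unclustered cid ↔ cid v = ⊤ := by simp [unclustered]
  rw [hU]
  refine and_congr_right fun _ => ?_
  constructor
  · rintro ⟨h1, h2⟩
    -- An active non-center is adjacent to a center, so the whole active set gets clustered.
    refine ⟨fun hv => ?_, h2⟩
    obtain ⟨u, hu, hadj, -⟩ := exists_adj_center hv h1
    exact h2 u hu hadj
  · rintro ⟨h1, h2⟩
    exact ⟨fun h => h1 (centers_subset _ _ _ _ h), h2⟩

theorem remaining_succ (π : Equiv.Perm (Fin n)) (t : ℕ) :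
    remaining alg G ε π (t + 1) = survivors alg G π (remaining alg G ε π t)
      (activeSet G ε π (remaining alg G ε π t)) :=
  unclustered_round alg G ε π _

theorem remaining_antitone (π : Equiv.Perm (Fin n)) : Antitone (remaining alg G ε π) := by
  refine antitone_nat_of_succ_le fun t v hv => ?_
  rw [remaining_succ, mem_survivors] at hv
  exact hv.1

theorem createClusters_congr {π π' : Equiv.Perm (Fin n)} {S : Finset (Fin n)}
    (h : ∀ v ∈ S, π' v = π v) (cid : ClusterID n) :
    createClusters G π' S cid = createClusters G π S cid := by
  funext v
  unfold createClusters
  split_ifs with h1 h2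
  · rfl
  · rw [h v h2]
  · exact Finset.inf_congr rfl fun u hu => by rw [h u (Finset.mem_filter.1 hu).1]

/-- Permuting the ranks of vertices that are left after `t` rounds does not affect these
rounds. -/
theorem run_mul {σ π : Equiv.Perm (Fin n)} {t : ℕ}
    (h : SupportedOn σ (remaining alg G ε π t)) :
    run alg G ε (π * σ) t = run alg G ε π t := by
  induction t with
  | zero => rfl
  | succ t ih =>
    have hsub := remaining_antitone alg G ε π (Nat.le_add_right t 1)
    have hrun := ih (h.mono hsub)
    set U := remaining alg G ε π t with hU
    -- Vertices left after round `t + 1` were not active in it, so `σ` fixes the whole batch.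
    have hact : ∀ v ∈ remaining alg G ε π (t + 1), v ∉ activeSet G ε π U := fun v hv => by
      rw [remaining_succ, mem_survivors] at hv
      exact hv.2.1
    have hA : activeSet G ε (π * σ) U = activeSet G ε π U := firstVertices_mul h hsub hact
    have hπ : ∀ v ∈ activeSet G ε π U, (π * σ) v = π v := fun v hv => by
      rw [Equiv.Perm.mul_apply, h v fun hv' => hact v hv' hv]
    change round alg G ε (π * σ) (run alg G ε (π * σ) t) = round alg G ε π (run alg G ε π t)
    rw [hrun]
    change createClusters G (π * σ) (centers alg G (π * σ) (activeSet G ε (π * σ) U)) _ =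
      createClusters G π (centers alg G π (activeSet G ε π U)) _
    rw [hA, centers_congr alg G hπ]
    exact createClusters_congr G (fun v hv => hπ v (centers_subset _ _ _ _ hv)) _

theorem remaining_mul {σ π : Equiv.Perm (Fin n)} {s t : ℕ} (hst : s ≤ t)
    (h : SupportedOn σ (remaining alg G ε π t)) :
    remaining alg G ε (π * σ) s = remaining alg G ε π s :=
  congrArg unclustered (run_mul alg G ε (h.mono (remaining_antitone alg G ε π hst)))

/-! ### Degrees and termination -/

/-- The number of neighbours of `v` in `U`. -/
def degIn (U : Finset (Fin n)) (v : Fin n) : ℕ :=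
  (U.filter (fun u => G.Adj v u)).card

theorem degIn_mono {U W : Finset (Fin n)} (h : W ⊆ U) (v : Fin n) :
    degIn G W v ≤ degIn G U v :=
  Finset.card_le_card (Finset.filter_subset_filter _ h)

theorem degIn_le_maxDeg {U : Finset (Fin n)} {v : Fin n} (hv : v ∈ U) :
    degIn G U v ≤ maxDeg G U :=
  Finset.le_sup (f := degIn G U) hv

theorem maxDeg_mono {U W : Finset (Fin n)} (h : W ⊆ U) : maxDeg G W ≤ maxDeg G U :=
  Finset.sup_le fun v hv => (degIn_mono G h v).trans (degIn_le_maxDeg G (h hv))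

theorem exists_degIn_eq_maxDeg {U : Finset (Fin n)} (h : 0 < maxDeg G U) :
    ∃ v ∈ U, degIn G U v = maxDeg G U := by
  have hU : U.Nonempty := by
    rw [Finset.nonempty_iff_ne_empty]
    rintro rfl
    simp [maxDeg] at h
  obtain ⟨v, hv, hv'⟩ := Finset.exists_mem_eq_sup U hU (degIn G U)
  exact ⟨v, hv, hv'.symm⟩

theorem maxDeg_lt_card {U : Finset (Fin n)} (h : 0 < maxDeg G U) : maxDeg G U < U.card := by
  obtain ⟨v, hv, hd⟩ := exists_degIn_eq_maxDeg G h
  rw [← hd]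
  exact Finset.card_lt_card ((Finset.ssubset_iff_of_subset (Finset.filter_subset _ _)).2
    ⟨v, hv, by simp⟩)

theorem maxDeg_univ : maxDeg G Finset.univ = G.maxDegree := by
  refine le_antisymm (Finset.sup_le fun v _ => ?_) (G.maxDegree_le_of_forall_degree_le _ ?_)
  · rw [← SimpleGraph.neighborFinset_eq_filter]
    exact G.degree_le_maxDegree v
  · intro v
    rw [← SimpleGraph.card_neighborFinset_eq_degree, SimpleGraph.neighborFinset_eq_filter]
    exact degIn_le_maxDeg G (Finset.mem_univ v)

theorem remaining_zero (π : Equiv.Perm (Fin n)) : remaining alg G ε π 0 = Finset.univ := by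
  simp [remaining, unclustered, run]

variable {ε}

theorem batchSize_pos (hε : 0 < ε) {U : Finset (Fin n)} (hU : U.Nonempty) :
    0 < batchSize G ε U := by
  have hU' := hU.card_pos
  unfold batchSize
  split_ifs with h
  · exact hU'
  · have : 0 < maxDeg G U := Nat.pos_of_ne_zero h
    positivity

/-- Guarantees that every one of the draws in a batch finds a vertex of `U`. -/
theorem batchSize_le_card (hε : ε ≤ 1) (U : Finset (Fin n)) :
    batchSize G ε U ≤ U.card := by
  unfold batchSize
  split_ifs with h
  · exact le_rfl
  · have h1 : (1 : ℝ) ≤ maxDeg G U := by exact_mod_cast Nat.pos_of_ne_zero h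
    rw [Nat.ceil_le, div_le_iff₀ (by linarith)]
    have : (0 : ℝ) ≤ U.card := by positivity
    nlinarith

theorem remaining_succ_eq_empty {π : Equiv.Perm (Fin n)} {t : ℕ}
    (h : maxDeg G (remaining alg G ε π t) = 0) : remaining alg G ε π (t + 1) = ∅ := by
  rw [Finset.eq_empty_iff_forall_notMem]
  intro v hv
  rw [remaining_succ, mem_survivors, activeSet, firstVertices_of_card_le] at hv
  · exact hv.2.1 hv.1
  · simp [batchSize, h]

/-- Each round removes at least the first active vertex. Hence only starting rounds below `n` enter
the union bound. -/
theorem card_remaining_le (hε : 0 < ε) (π : Equiv.Perm (Fin n)) (t : ℕ) :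
    (remaining alg G ε π t).card ≤ n - t := by
  induction t with
  | zero => simp [remaining_zero]
  | succ t ih =>
    rcases (remaining alg G ε π t).eq_empty_or_nonempty with h | h
    · have := Finset.card_le_card (remaining_antitone alg G ε π (Nat.le_add_right t 1))
      rw [h, Finset.card_empty] at this
      omega
    · obtain ⟨v, hv⟩ := firstVertices_nonempty π h (batchSize_pos G hε h)
      have : (remaining alg G ε π (t + 1)).card < (remaining alg G ε π t).card := by
        refine Finset.card_lt_card ((Finset.ssubset_iff_of_subset
          (remaining_antitone alg G ε π (Nat.le_add_right t 1))).2
          ⟨v, firstVertices_subset _ _ _ hv, fun hv' => ?_⟩)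
        rw [remaining_succ, mem_survivors] at hv'
        exact hv'.2.1 hv
      omega

end ParallelCC

namespace ParallelCC

variable {n : ℕ}

/-! ### The exchange argument -/

open Classical in
/-- If `Ω` is closed under exchanging the ranks of two elements of `W π`, then `next π` is
uniformly distributed on `W π`, so that it hits `N π ⊆ W π` with the expected frequency. -/
theorem card_filter_notMem_le (Ω : Finset (Equiv.Perm (Fin n)))
    (W N : Equiv.Perm (Fin n) → Finset (Fin n)) (next : Equiv.Perm (Fin n) → Fin n) (x : ℝ)
    (hswap : ∀ π ∈ Ω, ∀ y ∈ W π, ∀ z ∈ W π, π * Equiv.swap y z ∈ Ω ∧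
      W (π * Equiv.swap y z) = W π ∧ N (π * Equiv.swap y z) = N π ∧
      next (π * Equiv.swap y z) = Equiv.swap y z (next π))
    (hnext : ∀ π ∈ Ω, next π ∈ W π) (hN : ∀ π ∈ Ω, N π ⊆ W π)
    (hx : ∀ π ∈ Ω, x * (W π).card ≤ (N π).card) :
    ((Ω.filter (fun π => next π ∉ N π)).card : ℝ) ≤ (1 - x) * Ω.card := by
  have hmain : x * Ω.card ≤ ((Ω.filter (fun π => next π ∈ N π)).card : ℝ) := by
    -- Split `Ω` according to the pair `(W π, N π)`; within one class these sets are constant.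
    have h1 := Finset.card_eq_sum_card_image (fun π => (W π, N π)) Ω
    have h2 : (Ω.filter (fun π => next π ∈ N π)).card =
        ∑ p ∈ Ω.image (fun π => (W π, N π)),
          ((Ω.filter (fun π => next π ∈ N π)).filter (fun π => (W π, N π) = p)).card :=
      Finset.card_eq_sum_card_fiberwise fun π hπ =>
        Finset.mem_image_of_mem _ (Finset.filter_subset _ _ hπ)
    rw [h1, h2]
    push_cast
    rw [Finset.mul_sum]
    refine Finset.sum_le_sum fun p hp => ?_
    obtain ⟨π₀, hπ₀, rfl⟩ := Finset.mem_image.1 hp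
    set F := Ω.filter (fun π => (W π, N π) = (W π₀, N π₀)) with hF
    have hmem : ∀ π, π ∈ F ↔ π ∈ Ω ∧ W π = W π₀ ∧ N π = N π₀ := by simp [hF]
    -- Multiplication by the transposition injects the orders with next vertex `y` into those with
    -- next vertex `z`; by symmetry all values of `next` in `W π₀` are equally frequent.
    have hle : ∀ y ∈ W π₀, ∀ z ∈ W π₀, (F.filter (fun π => next π = y)).card ≤
        (F.filter (fun π => next π = z)).card := by
      intro y hy z hz
      refine Finset.card_le_card_of_injOn (fun π => π * Equiv.swap y z) ?_
        (mul_left_injective _).injOn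
      intro π hπ
      rw [Finset.mem_coe, Finset.mem_filter, hmem] at hπ
      obtain ⟨⟨hπΩ, hW, hN'⟩, rfl⟩ := hπ
      obtain ⟨a, b, c, d⟩ := hswap π hπΩ (next π) (hW ▸ hy) z (hW ▸ hz)
      rw [Finset.mem_coe, Finset.mem_filter, hmem]
      exact ⟨⟨a, b.trans hW, c.trans hN'⟩, by rw [d, Equiv.swap_apply_left]⟩
    set m := (F.filter (fun π => next π = next π₀)).card with hm
    have hconst : ∀ y ∈ W π₀, (F.filter (fun π => next π = y)).card = m := fun y hy =>
      le_antisymm (hle y hy _ (hnext _ hπ₀)) (hle _ (hnext _ hπ₀) y hy)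
    have hcF : F.card = (W π₀).card * m := by
      rw [Finset.card_eq_sum_card_fiberwise (f := next) (t := W π₀), Finset.sum_congr rfl hconst,
        Finset.sum_const, smul_eq_mul]
      intro π hπ
      obtain ⟨a, b, -⟩ := (hmem π).1 hπ
      exact b ▸ hnext π a
    have hcN : ((Ω.filter (fun π => next π ∈ N π)).filter
        (fun π => (W π, N π) = (W π₀, N π₀))).card = (N π₀).card * m := by
      rw [Finset.card_eq_sum_card_fiberwise (f := next) (t := N π₀), ← smul_eq_mul,
        ← Finset.sum_const]
      · refine Finset.sum_congr rfl fun y hy => ?_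
        rw [← hconst y (hN _ hπ₀ hy)]
        congr 1
        ext π
        simp only [Finset.mem_filter, hmem, Prod.mk.injEq]
        constructor
        · rintro ⟨⟨⟨a, b⟩, c⟩, d⟩
          exact ⟨⟨a, c⟩, d⟩
        · rintro ⟨⟨a, c⟩, d⟩
          exact ⟨⟨⟨a, by rw [d, c.2]; exact hy⟩, c⟩, d⟩
      · intro π hπ
        simp only [Finset.coe_filter, Finset.mem_filter, Set.mem_ofPred_eq, Prod.mk.injEq] at hπ
        rw [← hπ.2.2]
        exact hπ.1.2
    rw [hcF, hcN]
    push_cast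
    rw [← mul_assoc]
    exact mul_le_mul_of_nonneg_right (hx _ hπ₀) (Nat.cast_nonneg _)
  have hsplit := Finset.card_filter_add_card_filter_not (s := Ω) (fun π => next π ∈ N π)
  have : ((Ω.filter (fun π => next π ∈ N π)).card : ℝ) +
      ((Ω.filter (fun π => next π ∉ N π)).card : ℝ) = Ω.card := by exact_mod_cast hsplit
  linarith

/-! ### One round -/

variable (alg : Algorithm) (G : SimpleGraph (Fin n))

/-- The vertices of `U` that survive the first `j` vertices of `U`. -/
noncomputable def survivorsAfter (π : Equiv.Perm (Fin n)) (U : Finset (Fin n)) (j : ℕ) :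
    Finset (Fin n) :=
  survivors alg G π U (firstVertices π U j)

theorem survivorsAfter_mul {alg : Algorithm} {G : SimpleGraph (Fin n)}
    {σ π : Equiv.Perm (Fin n)} {U : Finset (Fin n)} {j : ℕ}
    (h : SupportedOn σ (U \ firstVertices π U j)) :
    survivorsAfter alg G (π * σ) U j = survivorsAfter alg G π U j := by
  unfold survivorsAfter
  rw [firstVertices_mul h Finset.sdiff_subset fun v hv => (Finset.mem_sdiff.1 hv).2]
  refine survivors_congr alg G U fun v hv => ?_
  rw [Equiv.Perm.mul_apply, h v fun hv' => (Finset.mem_sdiff.1 hv').2 hv]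

variable [DecidableRel G.Adj]

/-- The vertex `v` survives the first `j` vertices of `U`, and more than `D / 2` of its
neighbours do. -/
def StaysHeavy (π : Equiv.Perm (Fin n)) (U : Finset (Fin n)) (D j : ℕ) (v : Fin n) : Prop :=
  v ∈ survivorsAfter alg G π U j ∧ D < 2 * degIn G (survivorsAfter alg G π U j) v

variable {alg G}

theorem StaysHeavy.mono {π : Equiv.Perm (Fin n)} {U : Finset (Fin n)} {D j k : ℕ} {v : Fin n}
    (h : StaysHeavy alg G π U D k v) (hjk : j ≤ k) : StaysHeavy alg G π U D j v := by
  have hsub := survivors_firstVertices_subset alg G π U hjk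
  exact ⟨hsub h.1, h.2.trans_le (Nat.mul_le_mul_left 2 (degIn_mono G hsub v))⟩

-- The exchange lemma is applied with `next π` the vertex of rank `j`, `W π` the unseen part of `U`
-- and `N π` the surviving neighbours of `v`. If `next π` lies in `N π`, it becomes a center and `v`
-- is clustered.
open Classical in
theorem card_staysHeavy_succ_le {Ω : Finset (Equiv.Perm (Fin n))} {U : Finset (Fin n)}
    (hΩ : ∀ π ∈ Ω, ∀ y ∈ U, ∀ z ∈ U, π * Equiv.swap y z ∈ Ω) (D : ℕ) (v : Fin n) {j : ℕ}
    (hj : j < U.card) :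
    ((Ω.filter (fun π => StaysHeavy alg G π U D (j + 1) v)).card : ℝ) ≤
      (1 - D / (2 * U.card)) * (Ω.filter (fun π => StaysHeavy alg G π U D j v)).card := by
  choose next hnextU hnext using fun π : Equiv.Perm (Fin n) => exists_orderRank_eq π hj
  set W : Equiv.Perm (Fin n) → Finset (Fin n) := fun π => U \ firstVertices π U j with hW
  set N : Equiv.Perm (Fin n) → Finset (Fin n) := fun π =>
    (survivorsAfter alg G π U j).filter (fun u => G.Adj v u) with hNdef
  have hUpos : (0 : ℝ) < U.card := by exact_mod_cast (Nat.zero_le j).trans_lt hj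
  refine le_trans ?_ (card_filter_notMem_le (Ω.filter (fun π => StaysHeavy alg G π U D j v))
    W N next _ ?_ ?_ ?_ ?_)
  · refine Nat.cast_le.2 (Finset.card_le_card fun π hπ => ?_)
    rw [Finset.mem_filter] at hπ
    rw [Finset.mem_filter, Finset.mem_filter]
    refine ⟨⟨hπ.1, hπ.2.mono (Nat.le_add_right j 1)⟩, fun hmem => ?_⟩
    have hmem' := Finset.mem_filter.1 hmem
    exact (mem_survivors.1 hπ.2.1).2.2 _ (mem_centers_of_orderRank_eq hmem'.1 (hnext π)) hmem'.2
  · intro π hπ y hy z hz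
    rw [Finset.mem_filter] at hπ
    have hy' := (Finset.mem_sdiff.1 hy).1
    have hz' := (Finset.mem_sdiff.1 hz).1
    have hσ : SupportedOn (Equiv.swap y z) (U \ firstVertices π U j) := supportedOn_swap hy hz
    have hσU : SupportedOn (Equiv.swap y z) U := supportedOn_swap hy' hz'
    have hS := survivorsAfter_mul (alg := alg) (G := G) hσ
    refine ⟨?_, ?_, ?_, ?_⟩
    · rw [Finset.mem_filter]
      refine ⟨hΩ π hπ.1 y hy' z hz', ?_⟩
      unfold StaysHeavy
      rw [hS]
      exact hπ.2
    · simp only [hW]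
      rw [firstVertices_mul hσ Finset.sdiff_subset fun v hv => (Finset.mem_sdiff.1 hv).2]
    · simp only [hNdef, hS]
    · apply orderRank_injOn (π * Equiv.swap y z) U (hnextU _)
      · exact hσU.apply_mem_iff.2 (hnextU π)
      · rw [hnext, orderRank_mul hσU, Equiv.swap_apply_self, hnext]
  · intro π _
    refine Finset.mem_sdiff.2 ⟨hnextU π, fun h => ?_⟩
    have := (mem_firstVertices.1 h).2
    rw [hnext] at this
    exact lt_irrefl _ this
  · intro π _ u hu
    have := mem_survivors.1 (Finset.mem_filter.1 hu).1
    exact Finset.mem_sdiff.2 ⟨this.1, this.2.1⟩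
  · intro π hπ
    have h1 : D < 2 * (N π).card := (Finset.mem_filter.1 hπ).2.2
    have h2 : (W π).card ≤ U.card := Finset.card_le_card Finset.sdiff_subset
    have h1' : (D : ℝ) ≤ 2 * (N π).card := by exact_mod_cast h1.le
    have h2' : ((W π).card : ℝ) ≤ U.card := by exact_mod_cast h2
    calc (D : ℝ) / (2 * U.card) * (W π).card ≤ D / (2 * U.card) * U.card := by gcongr
      _ = D / 2 := by field_simp
      _ ≤ (N π).card := by linarith

open Classical in
theorem card_staysHeavy_le {Ω : Finset (Equiv.Perm (Fin n))} {U : Finset (Fin n)}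
    (hΩ : ∀ π ∈ Ω, ∀ y ∈ U, ∀ z ∈ U, π * Equiv.swap y z ∈ Ω) {D : ℕ} (hD : D ≤ U.card)
    (v : Fin n) {j : ℕ} (hj : j ≤ U.card) :
    ((Ω.filter (fun π => StaysHeavy alg G π U D j v)).card : ℝ) ≤
      (1 - D / (2 * U.card)) ^ j * Ω.card := by
  induction j with
  | zero =>
    rw [pow_zero, one_mul]
    exact Nat.cast_le.2 (Finset.card_filter_le _ _)
  | succ j ih =>
    have hUpos : (0 : ℝ) < U.card := by exact_mod_cast (Nat.zero_le j).trans_lt hj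
    have hq : (0 : ℝ) ≤ 1 - D / (2 * U.card) := by
      have : (D : ℝ) ≤ U.card := by exact_mod_cast hD
      rw [sub_nonneg, div_le_one (by positivity)]
      linarith
    calc _ ≤ _ := card_staysHeavy_succ_le hΩ D v hj
      _ ≤ (1 - D / (2 * U.card)) * ((1 - D / (2 * U.card)) ^ j * Ω.card) :=
        mul_le_mul_of_nonneg_left (ih (Nat.le_of_succ_le hj)) hq
      _ = _ := by ring

-- The batch size is chosen so that `B * D / (2 |U|) ≥ ε / 2`, whence `(1 - D / (2 |U|)) ^ B ≤ exp
-- (-ε / 2)`. For `D = 0` no vertex can stay heavy.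
open Classical in
theorem card_staysHeavy_batchSize_le {ε : ℝ} (hε : 0 < ε) (hε' : ε ≤ 1)
    {Ω : Finset (Equiv.Perm (Fin n))} {U : Finset (Fin n)}
    (hΩ : ∀ π ∈ Ω, ∀ y ∈ U, ∀ z ∈ U, π * Equiv.swap y z ∈ Ω) (v : Fin n) :
    ((Ω.filter (fun π => StaysHeavy alg G π U (maxDeg G U) (batchSize G ε U) v)).card : ℝ) ≤
      Real.exp (-(ε / 2)) * Ω.card := by
  rcases Nat.eq_zero_or_pos (maxDeg G U) with h0 | hpos
  · rw [Finset.card_eq_zero.2]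
    · simp only [Nat.cast_zero]
      positivity
    · refine Finset.filter_eq_empty_iff.2 fun π _ h => ?_
      have h1 := degIn_le_maxDeg G h.1
      have h2 := h.2
      have h3 : survivorsAfter alg G π U (batchSize G ε U) ⊆ U := fun u hu =>
        (mem_survivors.1 hu).1
      have h4 := maxDeg_mono G h3
      omega
  · have hlt := maxDeg_lt_card G hpos
    refine (card_staysHeavy_le hΩ hlt.le v (batchSize_le_card G hε' U)).trans
      (mul_le_mul_of_nonneg_right ?_ (Nat.cast_nonneg _))
    have hD : (0 : ℝ) < maxDeg G U := by exact_mod_cast hpos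
    have hDU : (maxDeg G U : ℝ) < U.card := by exact_mod_cast hlt
    have hU : (0 : ℝ) < U.card := hD.trans hDU
    have hB : ε * U.card / maxDeg G U ≤ batchSize G ε U := by
      rw [batchSize, if_neg hpos.ne']
      exact Nat.le_ceil _
    have hq : (0 : ℝ) ≤ 1 - maxDeg G U / (2 * U.card) := by
      rw [sub_nonneg, div_le_one (by positivity)]
      linarith
    calc (1 - (maxDeg G U : ℝ) / (2 * U.card)) ^ batchSize G ε U
        ≤ Real.exp (-(maxDeg G U / (2 * U.card))) ^ batchSize G ε U :=
          pow_le_pow_left₀ hq (Real.one_sub_le_exp_neg _) _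
      _ = Real.exp (-(batchSize G ε U * (maxDeg G U / (2 * U.card)))) := by
          rw [← Real.exp_nat_mul]
          ring_nf
      _ ≤ Real.exp (-(ε / 2)) := by
          rw [Real.exp_le_exp, neg_le_neg_iff]
          calc ε / 2 = ε * U.card / maxDeg G U * (maxDeg G U / (2 * U.card)) := by field_simp
            _ ≤ _ := by gcongr

/-! ### Consecutive rounds -/

variable (alg G)

/-- After round `t + 1`, the vertex `v` is left with a degree that exceeds half the maximum
degree before the round. -/
def HeavyAt (ε : ℝ) (v : Fin n) (t : ℕ) (π : Equiv.Perm (Fin n)) : Prop :=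
  v ∈ remaining alg G ε π (t + 1) ∧
    maxDeg G (remaining alg G ε π t) < 2 * degIn G (remaining alg G ε π (t + 1)) v

theorem heavyAt_iff {ε : ℝ} {v : Fin n} {t : ℕ} {π : Equiv.Perm (Fin n)} :
    HeavyAt alg G ε v t π ↔ StaysHeavy alg G π (remaining alg G ε π t)
      (maxDeg G (remaining alg G ε π t)) (batchSize G ε (remaining alg G ε π t)) v := by
  unfold HeavyAt StaysHeavy
  rw [remaining_succ]
  rfl

open Classical in
/-- A fixed vertex keeps a large degree during `r` consecutive rounds with probability at most
`exp (-ε r / 2)`. -/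
theorem card_heavyAt_le {ε : ℝ} (hε : 0 < ε) (hε' : ε ≤ 1) (v : Fin n) (i r : ℕ) :
    (((Finset.univ : Finset (Equiv.Perm (Fin n))).filter
      (fun π => ∀ t, i ≤ t → t < i + r → HeavyAt alg G ε v t π)).card : ℝ) ≤
      Real.exp (-(ε / 2)) ^ r * Fintype.card (Equiv.Perm (Fin n)) := by
  induction r with
  | zero =>
    rw [pow_zero, one_mul]
    exact Nat.cast_le.2 (Finset.card_le_univ _)
  | succ r ih =>
    set E : ℕ → Finset (Equiv.Perm (Fin n)) := fun r => Finset.univ.filter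
      (fun π => ∀ t, i ≤ t → t < i + r → HeavyAt alg G ε v t π) with hE
    have hstep : ((E (r + 1)).card : ℝ) ≤ Real.exp (-(ε / 2)) * (E r).card := by
      -- Condition on the set `U` left after `i + r` rounds and apply the one-round bound in each
      -- class.
      rw [Finset.card_eq_sum_card_fiberwise (s := E (r + 1))
          (f := fun π => remaining alg G ε π (i + r)) (t := Finset.univ) (by simp),
        Finset.card_eq_sum_card_fiberwise (s := E r)
          (f := fun π => remaining alg G ε π (i + r)) (t := Finset.univ) (by simp)]
      push_cast
      rw [Finset.mul_sum]
      refine Finset.sum_le_sum fun U _ => ?_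
      refine le_trans ?_ (card_staysHeavy_batchSize_le (alg := alg) (G := G) hε hε' (U := U) ?_ v)
      · refine Nat.cast_le.2 (Finset.card_le_card fun π hπ => ?_)
        simp only [hE, Finset.mem_filter, Finset.mem_univ, true_and] at hπ ⊢
        obtain ⟨h1, h2⟩ := hπ
        refine ⟨⟨fun t ht ht' => h1 t ht (by omega), h2⟩, ?_⟩
        have := (heavyAt_iff alg G).1 (h1 (i + r) (by omega) (by omega))
        rwa [h2] at this
      · intro π hπ y hy z hz
        simp only [hE, Finset.mem_filter, Finset.mem_univ, true_and] at hπ ⊢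
        obtain ⟨h1, rfl⟩ := hπ
        -- Exchanging two remaining vertices changes none of the first `i + r` rounds, so the class
        -- is closed under such exchanges.
        have hσ := supportedOn_swap hy hz
        refine ⟨fun t ht ht' => ?_, remaining_mul alg G ε le_rfl hσ⟩
        unfold HeavyAt
        rw [remaining_mul alg G ε (by omega) hσ, remaining_mul alg G ε (by omega) hσ]
        exact h1 t ht ht'
    calc ((E (r + 1)).card : ℝ) ≤ _ := hstep
      _ ≤ Real.exp (-(ε / 2)) * (Real.exp (-(ε / 2)) ^ r *
          Fintype.card (Equiv.Perm (Fin n))) := by gcongr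
      _ = _ := by ring

/-! ### The maximum degree halves -/

/-- The maximum degree halves whenever at least `L` rounds pass. -/
def HalvesWithin (ε L : ℝ) (π : Equiv.Perm (Fin n)) : Prop :=
  ∀ i s : ℕ, L ≤ s → (maxDeg G (remaining alg G ε π (i + s)) : ℝ) ≤
    (maxDeg G (remaining alg G ε π i) : ℝ) / 2

variable {alg G}

/-- The witness is a vertex of maximum degree after `i + ⌈L⌉₊` rounds. Degrees and maximum degrees
only decrease, so it was heavy in each of these rounds. -/
theorem exists_heavyAt_of_not_halvesWithin {ε L : ℝ} (hε : 0 < ε) {π : Equiv.Perm (Fin n)}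
    (h : ¬ HalvesWithin alg G ε L π) :
    ∃ i < n, ∃ v, ∀ t, i ≤ t → t < i + ⌈L⌉₊ → HeavyAt alg G ε v t π := by
  unfold HalvesWithin at h
  push Not at h
  obtain ⟨i, s, hs, hlt⟩ := h
  have hanti := remaining_antitone alg G ε π
  have hs' : ⌈L⌉₊ ≤ s := Nat.ceil_le.2 hs
  have h1 := maxDeg_mono G (hanti (Nat.add_le_add_left hs' i))
  have h2 : maxDeg G (remaining alg G ε π i) < 2 * maxDeg G (remaining alg G ε π (i + s)) := by
    have : (maxDeg G (remaining alg G ε π i) : ℝ) <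
        2 * maxDeg G (remaining alg G ε π (i + s)) := by linarith
    exact_mod_cast this
  obtain ⟨v, hv, hd⟩ := exists_degIn_eq_maxDeg G
    (U := remaining alg G ε π (i + ⌈L⌉₊)) (by omega)
  refine ⟨i, ?_, v, fun t ht ht' => ⟨hanti (show t + 1 ≤ i + ⌈L⌉₊ by omega) hv, ?_⟩⟩
  · have h3 := card_remaining_le alg G hε π i
    have h4 := Finset.card_pos.2 ⟨v, hanti (Nat.le_add_right i _) hv⟩
    omega
  · have h3 := maxDeg_mono G (hanti ht)
    have h4 := degIn_mono G (hanti (show t + 1 ≤ i + ⌈L⌉₊ by omega)) v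
    omega

theorem maxDeg_remaining_mul_le {ε L : ℝ} {π : Equiv.Perm (Fin n)}
    (h : HalvesWithin alg G ε L π) (k : ℕ) :
    (maxDeg G (remaining alg G ε π (k * ⌈L⌉₊)) : ℝ) ≤ G.maxDegree / 2 ^ k := by
  induction k with
  | zero => simp [remaining_zero, maxDeg_univ]
  | succ k ih =>
    have := h (k * ⌈L⌉₊) ⌈L⌉₊ (Nat.le_ceil L)
    rw [add_one_mul, pow_succ, ← div_div]
    linarith

/-- After `⌊log₂ Δ⌋ + 1` halvings the maximum degree is below `1`, hence `0`; the extra round then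
activates every remaining vertex. -/
theorem remaining_eq_empty_of_halvesWithin {ε L : ℝ} {π : Equiv.Perm (Fin n)}
    (h : HalvesWithin alg G ε L π) :
    remaining alg G ε π ((Nat.log 2 G.maxDegree + 1) * ⌈L⌉₊ + 1) = ∅ := by
  apply remaining_succ_eq_empty
  have h1 := maxDeg_remaining_mul_le h (Nat.log 2 G.maxDegree + 1)
  have h2 : (G.maxDegree : ℝ) < 2 ^ (Nat.log 2 G.maxDegree + 1) := by
    exact_mod_cast Nat.lt_pow_succ_log_self one_lt_two G.maxDegree
  have h3 : (maxDeg G (remaining alg G ε π ((Nat.log 2 G.maxDegree + 1) * ⌈L⌉₊)) : ℝ) < 1 :=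
    h1.trans_lt ((div_lt_one (by positivity)).2 h2)
  have : maxDeg G (remaining alg G ε π ((Nat.log 2 G.maxDegree + 1) * ⌈L⌉₊)) < 1 := by
    exact_mod_cast h3
  omega

/-! ### Probabilities -/

theorem permProb_mono {E F : Set (Equiv.Perm (Fin n))} (h : E ⊆ F) :
    permProb n E ≤ permProb n F := by
  unfold permProb
  gcongr
  exact Set.toFinite F

-- Union bound: the factor `n ^ 2` counts the pairs of a starting round and a vertex.
open Classical in
theorem one_sub_le_permProb_halvesWithin {ε L : ℝ} (hε : 0 < ε) (hε' : ε ≤ 1) :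
    1 - (n : ℝ) ^ 2 * Real.exp (-(ε * L / 2)) ≤ permProb n {π | HalvesWithin alg G ε L π} := by
  set M : ℝ := (Fintype.card (Equiv.Perm (Fin n)) : ℝ) with hM
  have hMpos : 0 < M := by
    rw [hM]
    exact_mod_cast Fintype.card_pos
  set bad : Finset (Equiv.Perm (Fin n)) := Finset.univ.filter
    (fun π => ¬ HalvesWithin alg G ε L π) with hbad
  set q : ℝ := Real.exp (-(ε / 2)) ^ ⌈L⌉₊ with hq
  have hcard : (bad.card : ℝ) ≤ (n : ℝ) ^ 2 * (q * M) := by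
    have hsub : bad ⊆ (Finset.range n ×ˢ (Finset.univ : Finset (Fin n))).biUnion fun p =>
        Finset.univ.filter
          (fun π => ∀ t, p.1 ≤ t → t < p.1 + ⌈L⌉₊ → HeavyAt alg G ε p.2 t π) := by
      intro π hπ
      obtain ⟨i, hi, v, h⟩ := exists_heavyAt_of_not_halvesWithin hε (Finset.mem_filter.1 hπ).2
      refine Finset.mem_biUnion.2 ⟨(i, v), ?_, ?_⟩
      · simpa using hi
      · rw [Finset.mem_filter]
        exact ⟨Finset.mem_univ _, h⟩
    calc (bad.card : ℝ) ≤ ∑ p ∈ Finset.range n ×ˢ (Finset.univ : Finset (Fin n)),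
          ((Finset.univ.filter (fun π : Equiv.Perm (Fin n) =>
            ∀ t, p.1 ≤ t → t < p.1 + ⌈L⌉₊ → HeavyAt alg G ε p.2 t π)).card : ℝ) := by
          exact_mod_cast (Finset.card_le_card hsub).trans Finset.card_biUnion_le
      _ ≤ ∑ p ∈ Finset.range n ×ˢ (Finset.univ : Finset (Fin n)), q * M :=
          Finset.sum_le_sum fun p _ => card_heavyAt_le alg G hε hε' p.2 p.1 ⌈L⌉₊
      _ = (n : ℝ) ^ 2 * (q * M) := by
          simp [Finset.card_product, sq]
  have hqle : q ≤ Real.exp (-(ε * L / 2)) := by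
    rw [hq, ← Real.exp_nat_mul, Real.exp_le_exp]
    have := Nat.le_ceil L
    nlinarith
  have hgood : ({π | HalvesWithin alg G ε L π} : Set (Equiv.Perm (Fin n))).ncard + bad.card =
      Fintype.card (Equiv.Perm (Fin n)) := by
    have h1 : ({π | HalvesWithin alg G ε L π} : Set (Equiv.Perm (Fin n))).ncard =
        ((Finset.univ : Finset (Equiv.Perm (Fin n))).filter
          (fun π => HalvesWithin alg G ε L π)).card := by
      rw [← Set.ncard_coe_finset]
      simp
    rw [h1, hbad, Finset.card_filter_add_card_filter_not, Finset.card_univ]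
  have hgood' : (({π | HalvesWithin alg G ε L π} : Set (Equiv.Perm (Fin n))).ncard : ℝ) =
      M - bad.card := by
    rw [hM, ← hgood]
    push_cast
    ring
  unfold permProb
  rw [hgood', le_div_iff₀ hMpos]
  have : (n : ℝ) ^ 2 * (q * M) ≤ (n : ℝ) ^ 2 * (Real.exp (-(ε * L / 2)) * M) := by gcongr
  change (1 - (n : ℝ) ^ 2 * Real.exp (-(ε * L / 2))) * M ≤ M - bad.card
  linarith

end ParallelCC

/-! ### The choice of constants -/

theorem lemma1 (c : ℝ) (hc : 0 < c) :
    ∃ C : ℝ, 0 < C ∧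
      ∀ (alg : ParallelCC.Algorithm) (n : ℕ) (G : SimpleGraph (Fin n)) [DecidableRel G.Adj]
        (ε : ℝ), 0 < ε → ε ≤ 1 → 2 ≤ G.maxDegree →
        (1 - (n : ℝ) ^ (-c) ≤ ParallelCC.permProb n
          {π | ParallelCC.TerminatesWithin alg G ε π
            (C * ((1 / ε) * Real.log (n : ℝ) * Real.log (G.maxDegree : ℝ)))}) ∧
        (1 - (n : ℝ) ^ (-c) ≤ ParallelCC.permProb n
          {π | ∀ i s : ℕ, C * ((1 / ε) * Real.log (n : ℝ)) ≤ (s : ℝ) →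
            (ParallelCC.maxDeg G (ParallelCC.remaining alg G ε π (i + s)) : ℝ) ≤
              (ParallelCC.maxDeg G (ParallelCC.remaining alg G ε π i) : ℝ) / 2}) := by
  -- With `L = C₀ * l` and `l = log n / ε`, the failure bound `n ^ 2 * exp (-ε L / 2)` equals `n ^ 2
  -- * n ^ (-(c + 2)) = n ^ (-c)`.
  set C₀ : ℝ := 2 * (c + 2) with hC₀
  have hC₀pos : 0 < C₀ := by positivity
  -- Part (1) needs `4 * (C₀ + 1) + 2`: the factor `4` bounds `⌊log₂ Δ⌋ + 1` by `4 * log Δ`, the `+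
  -- 1` absorbs the ceiling, and the `2` pays for the last round.
  refine ⟨4 * C₀ + 6, by positivity, fun alg n G _ ε hε hε' hΔ => ?_⟩
  -- A vertex of degree at least `2` forces `n ≥ 3 > e`, so `log n ≥ 1` and `l ≥ 1`, which lets `l`
  -- absorb the rounding terms.
  have hn : 3 ≤ n := by
    have h0 : 0 < ParallelCC.maxDeg G Finset.univ := by
      rw [ParallelCC.maxDeg_univ]
      omega
    have := ParallelCC.maxDeg_lt_card G h0
    rw [ParallelCC.maxDeg_univ, Finset.card_fin] at this
    omega
  have hn' : (3 : ℝ) ≤ n := by exact_mod_cast hn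
  have hnpos : (0 : ℝ) < n := by linarith
  have hlogn : 1 ≤ Real.log n := by
    rw [Real.le_log_iff_exp_le hnpos]
    linarith [Real.exp_one_lt_d9]
  set l : ℝ := 1 / ε * Real.log n with hl
  have hl1 : 1 ≤ l := by
    have : 1 ≤ 1 / ε := (one_le_div hε).2 hε'
    nlinarith
  have hprob : 1 - (n : ℝ) ^ (-c) ≤
      ParallelCC.permProb n {π | ParallelCC.HalvesWithin alg G ε (C₀ * l) π} := by
    refine le_trans (le_of_eq ?_)
      (ParallelCC.one_sub_le_permProb_halvesWithin (alg := alg) (G := G) hε hε')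
    have h1 : -(ε * (C₀ * l) / 2) = Real.log n * (-(c + 2)) := by
      rw [hl, hC₀]
      field_simp
    rw [h1, ← Real.rpow_def_of_pos hnpos, ← Real.rpow_natCast, ← Real.rpow_add hnpos]
    congr 2
    push_cast
    ring
  refine ⟨hprob.trans (ParallelCC.permProb_mono fun π hπ => ?_),
    hprob.trans (ParallelCC.permProb_mono fun π hπ i s hs => hπ i s (le_trans ?_ hs))⟩
  · refine ⟨_, ?_, ParallelCC.remaining_eq_empty_of_halvesWithin hπ⟩
    have hD : (2 : ℝ) ≤ G.maxDegree := by exact_mod_cast hΔ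
    set d : ℝ := Real.log G.maxDegree with hd
    have hlog2 := Real.log_two_gt_d9
    have hd2 : Real.log 2 ≤ d := Real.log_le_log two_pos hD
    have hlog : (Nat.log 2 G.maxDegree : ℝ) * Real.log 2 ≤ d := by
      rw [← Real.log_pow]
      refine Real.log_le_log (by positivity) ?_
      exact_mod_cast Nat.pow_log_le_self 2 (by omega : G.maxDegree ≠ 0)
    have hk : (Nat.log 2 G.maxDegree : ℝ) + 1 ≤ 4 * d := by
      have : (0 : ℝ) ≤ Nat.log 2 G.maxDegree := Nat.cast_nonneg _
      nlinarith
    have hs : (⌈C₀ * l⌉₊ : ℝ) ≤ (C₀ + 1) * l := by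
      have := Nat.ceil_lt_add_one (a := C₀ * l) (by positivity)
      linarith
    push_cast
    calc ((Nat.log 2 G.maxDegree : ℝ) + 1) * ⌈C₀ * l⌉₊ + 1
        ≤ 4 * d * ((C₀ + 1) * l) + 2 * (d * l) := by
          gcongr
          nlinarith
      _ = (4 * C₀ + 6) * (l * d) := by ring
  · nlinarith
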